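/- For a finite register of qubits, a quantum operator is a unitary matrix indexed by the classical basis states (bit strings, one bit per qubit). A one-layer circuit is a tensor product of arbitrary one- and two-qubit unitary gates acting on disjoint qubits that together cover the register (an idle qubit carries the identity gate), and a circuit of depth $d$ is a product of $d$ one-layer circuits (for $d=0$, the identity). An operator $F$ on $n$ qubits is embedded in an operator $M$ on $n+m$ qubits, with $m$ ancillae, if $M$ maps the subspace on which all $m$ ancillae are in state $|0\rangle$ into itself and satisfies $M(|\psi\rangle\otimes|0\rangle^{\otimes m})=(F|\psi\rangle)\otimes|0\rangle^{\otimes m}$ for every state $|\psi\rangle$ of the $n$ qubits. A family $(F(n))_n$ of quantum operators, with $F(n)$ acting on $n$ qubits, is in $\mathbf{QNC}^k$ if there are constants $c_1,c_2,j$ such that for every $n\ge 1$ the operator $F(n)$ can be embedded in a circuit of depth at most $c_1\log^k n$ with at most $c_2n^j$ ancillae. **Proposition.** There are absolute constants $c_1,c_2$ such that for every $n\ge 1$, every operator on $n$ qubits that is given by a circuit composed entirely of controlled-not gates (of any length, between arbitrary pairs of distinct qubits) can be embedded in a circuit of depth at most $c_1\log n$ with at most $c_2n^2$ ancillae. Consequently,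 every family $(F(n))_n$ in which each $F(n)$ is the operator of a circuit on $n$ qubits composed entirely of controlled-not gates is in $\mathbf{QNC}^1$. -/

import Mathlib

namespace QCirc

/-- Classical basis states of a register whose qubits are labelled by `ι`: one bit per qubit. -/
abbrev Bits (ι : Type) : Type := ι → ZMod 2

/-- Complex matrices on the register `ι`. The entry `U b a` is the amplitude from the incoming
truth values `a` to the outgoing truth values `b`. -/
abbrev Op (ι : Type) : Type := Matrix (Bits ι) (Bits ι) ℂ

/-- Quantum operators on the register `ι` are the unitary matrices. -/
def IsQuantumOperator {ι : Type} [Fintype ι] [DecidableEq ι] (U : Op ι) : Prop :=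
  U ∈ Matrix.unitaryGroup (Bits ι) ℂ

/-- `U` is a one-layer circuit: the register is partitioned into blocks of one or two qubits
(the parts of a `Finpartition` are nonempty), each block `s` carries an arbitrary unitary gate
`g s` acting on the qubits of `s` only, and `U` is the tensor product of these gates. A qubit on
which nothing happens is a block of size one with the identity gate. -/
def IsOneLayer {ι : Type} [Fintype ι] [DecidableEq ι] (U : Op ι) : Prop :=
  ∃ (P : Finpartition (Finset.univ : Finset ι)) (g : ∀ s : Finset ι, Op s),
    (∀ s ∈ P.parts, s.card ≤ 2) ∧
    (∀ s ∈ P.parts, IsQuantumOperator (g s)) ∧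
    ∀ b a : Bits ι, U b a = ∏ s ∈ P.parts, g s (fun i => b i) (fun i => a i)

/-- `U` is a quantum circuit of depth `d`: a product of `d` one-layer circuits
(the empty product, of depth `0`, is the identity). -/
def IsCircuitOfDepth {ι : Type} [Fintype ι] [DecidableEq ι] (d : ℕ) (U : Op ι) : Prop :=
  ∃ L : List (Op ι), L.length = d ∧ (∀ V ∈ L, IsOneLayer V) ∧ L.prod = U

/-- `F`, on `n` qubits, is embedded in `M` with `m` ancillae: `M` preserves the subspace on which
all ancillae are `|0⟩`, and on that subspace it acts as `F` on the `n` qubits. The ancillae are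
the qubits of the second summand of `Fin n ⊕ Fin m`. -/
def IsEmbeddedIn {n m : ℕ} (F : Op (Fin n)) (M : Op (Fin n ⊕ Fin m)) : Prop :=
  (∀ (a b : Bits (Fin n)) (c : Bits (Fin m)), c ≠ 0 → M (Sum.elim b c) (Sum.elim a 0) = 0) ∧
  (∀ a b : Bits (Fin n), M (Sum.elim b 0) (Sum.elim a 0) = F b a)

/-- The class `QNC^k` of families of quantum operators, `F n` acting on `n` qubits: for some
constants `c₁`, `c₂`, `j`, each `F n` with `n ≥ 1` can be embedded in a circuit of depth at most
`c₁ (log n)^k` with at most `c₂ n^j` ancillae. -/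
def QNC (k : ℕ) : Set (∀ n : ℕ, Op (Fin n)) :=
  {F | (∀ n, IsQuantumOperator (F n)) ∧
    ∃ (c₁ c₂ : ℝ) (j : ℕ), ∀ n : ℕ, 1 ≤ n →
      ∃ (m d : ℕ) (M : Op (Fin n ⊕ Fin m)),
        (d : ℝ) ≤ c₁ * Real.log n ^ k ∧ (m : ℝ) ≤ c₂ * (n : ℝ) ^ j ∧
        IsCircuitOfDepth d M ∧ IsEmbeddedIn (F n) M}

/-- The controlled-not gate with input qubit `c` and target qubit `t`, as an operator on the whole
register: it sends the basis state `a` to the one with `a t` replaced by `a t + a c` (mod 2). -/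
def cnot {ι : Type} [Fintype ι] [DecidableEq ι] (c t : ι) : Op ι :=
  Matrix.of fun b a => if b = Function.update a t (a t + a c) then 1 else 0

/-- `U` is the operator of a circuit composed entirely of controlled-not gates: the product of
finitely many controlled-not gates, each with distinct input and target qubits. Gates performed
simultaneously act on disjoint qubits and are simply listed one after another. -/
def IsCnotCircuit {ι : Type} [Fintype ι] [DecidableEq ι] (U : Op ι) : Prop :=
  ∃ L : List (ι × ι), (∀ p ∈ L, p.1 ≠ p.2) ∧ (L.map fun p => cnot p.1 p.2).prod = U

end QCirc

namespace QCirc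

open Function

/-! ### Layers of controlled-not gates as maps on bit strings -/

section Classical

variable {ι κ : Type}

/-! A controlled-not circuit, however long, only applies an invertible linear map `f` over `ZMod 2`
to the basis states, so it is enough to compute `f` in logarithmic depth.

With about `n ^ 2` ancillae, every bit is fanned out by repeated doubling, one layer forms all the
products `M i j * x j`, and the rows of the matrix are summed by binary trees (`exists_fanout_sum`).
Copying the result out and reversing the computation clears the work space (`exists_addLinear`).

Adding `f x` to a blank register and then `f.symm (f x) = x` to the input register erases the input.
This makes `f` act in place (`exists_cnotDepth_linearEquiv`). `IsCnotLayer.isOneLayer` turns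
classical layers into one-layer circuits. -/

/-- A classical map on bit strings that performs simultaneous controlled-not gates on pairwise
disjoint pairs `(c k, t k)` of qubits. -/
def IsCnotLayer (f : Bits ι → Bits ι) : Prop :=
  ∃ (K : Type) (c t : K → ι), Injective c ∧ Injective t ∧ (∀ k l, c k ≠ t l) ∧
    (∀ a k, f a (t k) = a (t k) + a (c k)) ∧ ∀ a i, i ∉ Set.range t → f a i = a i

/-- A classical map on bit strings computed by `d` successive layers of controlled-not gates. -/
inductive CnotDepth : ℕ → (Bits ι → Bits ι) → Prop
  | zero : CnotDepth 0 id
  | succ {d : ℕ} {f g : Bits ι → Bits ι} :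
      CnotDepth d f → IsCnotLayer g → CnotDepth (d + 1) (g ∘ f)

theorem exists_cnotLayer {K : Type} {c t : K → ι} (hc : Injective c) (ht : Injective t)
    (hct : ∀ k l, c k ≠ t l) :
    ∃ f : Bits ι → Bits ι, CnotDepth 1 f ∧
      (∀ a k, f a (t k) = a (t k) + a (c k)) ∧ ∀ a i, i ∉ Set.range t → f a i = a i := by
  let f : Bits ι → Bits ι := fun a => extend t (fun k => a (t k) + a (c k)) a
  have h₁ : ∀ a k, f a (t k) = a (t k) + a (c k) := fun a k => ht.extend_apply _ _ k
  have h₂ : ∀ a i, i ∉ Set.range t → f a i = a i := fun a i hi => extend_apply' _ _ _ hi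
  exact ⟨f, CnotDepth.succ CnotDepth.zero ⟨K, c, t, hc, ht, hct, h₁, h₂⟩, h₁, h₂⟩

theorem IsCnotLayer.involutive {f : Bits ι → Bits ι} (hf : IsCnotLayer f) : Involutive f := by
  obtain ⟨K, c, t, hc, ht, hct, h₁, h₂⟩ := hf
  intro a
  funext i
  by_cases hi : i ∈ Set.range t
  · obtain ⟨k, rfl⟩ := hi
    have : c k ∉ Set.range t := fun ⟨l, hl⟩ => hct k l hl.symm
    rw [h₁, h₁, h₂ a _ this, add_assoc, CharTwo.add_self_eq_zero, add_zero]
  · rw [h₂ _ _ hi, h₂ _ _ hi]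

theorem CnotDepth.comp {d e : ℕ} {f g : Bits ι → Bits ι} (hg : CnotDepth e g)
    (hf : CnotDepth d f) : CnotDepth (d + e) (g ∘ f) := by
  induction hg with
  | zero => exact hf
  | succ _ hl ih => exact CnotDepth.succ (f := _ ∘ f) ih hl

/-- Each layer is an involution, so the layers are run in reverse order. This serves to uncompute
the work qubits. -/
theorem CnotDepth.exists_leftInverse {d : ℕ} {f : Bits ι → Bits ι} (hf : CnotDepth d f) :
    ∃ g, CnotDepth d g ∧ LeftInverse g f := by
  induction hf with
  | zero => exact ⟨id, CnotDepth.zero, fun _ => rfl⟩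
  | @succ d f l _ hl ih =>
    obtain ⟨g, hg, hgf⟩ := ih
    refine ⟨g ∘ l, ?_, fun a => ?_⟩
    · rw [add_comm]
      exact hg.comp (CnotDepth.succ CnotDepth.zero hl)
    · simp only [comp_apply]
      rw [hl.involutive, hgf]

/-- The action of a map on the qubits in the range of `j`, the other qubits being left alone. -/
noncomputable def lift (j : κ → ι) (f : Bits κ → Bits κ) (a : Bits ι) : Bits ι :=
  extend j (f (a ∘ j)) a

theorem lift_apply {j : κ → ι} (hj : Injective j) (f : Bits κ → Bits κ) (a : Bits ι) (i : κ) :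
    lift j f a (j i) = f (a ∘ j) i :=
  hj.extend_apply _ _ i

theorem lift_comp_self {j : κ → ι} (hj : Injective j) (f : Bits κ → Bits κ) (a : Bits ι) :
    lift j f a ∘ j = f (a ∘ j) :=
  funext (lift_apply hj f a)

theorem lift_apply_of_notMem {j : κ → ι} (f : Bits κ → Bits κ) (a : Bits ι) {i : ι}
    (hi : i ∉ Set.range j) : lift j f a i = a i :=
  extend_apply' _ _ _ hi

theorem CnotDepth.lift {j : κ → ι} (hj : Injective j) {d : ℕ} {f : Bits κ → Bits κ}
    (hf : CnotDepth d f) : CnotDepth d (lift j f) := by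
  induction hf with
  | zero =>
    have : QCirc.lift j id = id := by
      funext a i
      by_cases hi : i ∈ Set.range j
      · obtain ⟨k, rfl⟩ := hi
        rw [lift_apply hj]; rfl
      · rw [lift_apply_of_notMem _ _ hi]; rfl
    rw [this]
    exact CnotDepth.zero
  | @succ d f l _ hl ih =>
    have : QCirc.lift j (l ∘ f) = QCirc.lift j l ∘ QCirc.lift j f := by
      funext a i
      rw [comp_apply]
      by_cases hi : i ∈ Set.range j
      · obtain ⟨k, rfl⟩ := hi
        rw [lift_apply hj, lift_apply hj, lift_comp_self hj]; rfl
      · simp only [lift_apply_of_notMem _ _ hi]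
    rw [this]
    refine CnotDepth.succ ih ?_
    obtain ⟨K, c, t, hc, ht, hct, h₁, h₂⟩ := hl
    refine ⟨K, j ∘ c, j ∘ t, hj.comp hc, hj.comp ht, fun k k' h => hct k k' (hj h), ?_, ?_⟩
    · intro a k
      simp only [comp_apply]
      rw [lift_apply hj, h₁]; rfl
    · intro a i hi
      by_cases hi' : i ∈ Set.range j
      · obtain ⟨k, rfl⟩ := hi'
        rw [lift_apply hj, h₂]; · rfl
        rintro ⟨k', rfl⟩
        exact hi ⟨k', rfl⟩
      · rw [lift_apply_of_notMem _ _ hi']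

/-! ### Fan-out and parity by binary trees -/

/-- In `k` layers, on every copy of a suitable set of `2 ^ k` qubits, one can add up all the bits
into one qubit `top`; the same layers distribute a single bit from `bot` to all the qubits. -/
theorem exists_fanout_sum (k : ℕ) :
    ∃ (Q : Type) (_ : Fintype Q) (bot top : Q), Fintype.card Q = 2 ^ k ∧
      ∀ (ι R : Type) (φ : R × Q → ι), Injective φ →
        ∃ f : Bits ι → Bits ι, CnotDepth k f ∧ (∀ a i, i ∉ Set.range φ → f a i = a i) ∧
          (∀ a r, (∀ q, q ≠ bot → a (φ (r, q)) = 0) → ∀ q, f a (φ (r, q)) = a (φ (r, bot))) ∧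
          ∀ a r, f a (φ (r, top)) = ∑ q, a (φ (r, q)) := by
  induction k with
  | zero =>
    refine ⟨Unit, inferInstance, (), (), rfl, fun ι R φ _ => ?_⟩
    exact ⟨id, CnotDepth.zero, fun _ _ _ => rfl, fun _ _ _ _ => rfl, fun a r => by simp⟩
  | succ k ih =>
    obtain ⟨Q, _, bot, top, hQ, H⟩ := ih
    refine ⟨Bool × Q, inferInstance, (false, bot), (true, top), ?_, fun ι R φ hφ => ?_⟩
    · rw [Fintype.card_prod, hQ, Fintype.card_bool, pow_succ, mul_comm]
    -- Adding the `false` half onto the `true` half seeds the second half for fan-out, and forms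
    -- pairwise sums for parity.
    obtain ⟨l, hl, hl₁, hl₂⟩ := exists_cnotLayer (K := R × Q)
      (c := fun p => φ (p.1, false, p.2)) (t := fun p => φ (p.1, true, p.2))
      (fun p p' h => by simpa [Prod.ext_iff] using hφ h)
      (fun p p' h => by simpa [Prod.ext_iff] using hφ h)
      (fun p p' h => by simpa using hφ h)
    have hl₃ : ∀ a r q, l a (φ (r, true, q)) = a (φ (r, true, q)) + a (φ (r, false, q)) :=
      fun a r q => hl₁ a (r, q)
    have hl₄ : ∀ a r q, l a (φ (r, false, q)) = a (φ (r, false, q)) := by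
      intro a r q
      apply hl₂
      rintro ⟨p, hp⟩
      simpa using hφ hp
    -- Both halves are treated in parallel as further copies, which is why the statement allows an
    -- arbitrary index type `R`.
    obtain ⟨f, hf, hf₁, hf₂, hf₃⟩ := H ι (R × Bool) (fun p => φ (p.1.1, p.1.2, p.2))
      (fun p p' h => by
        have := hφ h
        simp only [Prod.ext_iff] at this ⊢
        tauto)
    refine ⟨f ∘ l, add_comm k 1 ▸ hf.comp hl, ?_, ?_, ?_⟩
    · intro a i hi
      rw [comp_apply, hf₁, hl₂]
      · rintro ⟨p, rfl⟩; exact hi ⟨_, rfl⟩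
      · rintro ⟨p, rfl⟩; exact hi ⟨_, rfl⟩
    · rintro a r ha ⟨b, q⟩
      have key := hf₂ (l a) (r, b) ?_ q
      · refine key.trans ?_
        cases b
        · exact hl₄ a r bot
        · refine (hl₃ a r bot).trans ?_
          rw [ha (true, bot) (by simp), zero_add]
      · intro q hq
        have h₀ : ∀ b, a (φ (r, b, q)) = 0 := fun b => ha _ (by simp [hq])
        cases b
        · exact (hl₄ a r q).trans (h₀ _)
        · refine (hl₃ a r q).trans ?_
          rw [h₀, h₀, add_zero]
    · intro a r
      refine (hf₃ (l a) (r, true)).trans ?_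
      simp only [hl₃, Fintype.sum_prod_type, Fintype.sum_bool, Finset.sum_add_distrib]

theorem involutive_update_add [DecidableEq ι] {c t : ι} (hct : c ≠ t) :
    Involutive fun a : Bits ι => update a t (a t + a c) := by
  intro a
  simp [update_of_ne hct, add_assoc, CharTwo.add_self_eq_zero]

end Classical

/-! ### Linear maps in logarithmic depth -/

/-- With a work register of `2 n 2 ^ k ≥ 2 n ^ 2` qubits, any linear map can be applied to one
register of `n` qubits and added to another one by `4 k + 5` layers of controlled-not gates. -/
theorem exists_addLinear (n k : ℕ) (hk : n ≤ 2 ^ k) :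
    ∃ (W : Type) (_ : Fintype W), Fintype.card W = 2 * (n * 2 ^ k) ∧
      ∀ f : Bits (Fin n) →ₗ[ZMod 2] Bits (Fin n),
        ∃ g : Bits (Fin n ⊕ (Fin n ⊕ W)) → Bits (Fin n ⊕ (Fin n ⊕ W)),
          CnotDepth (4 * k + 5) g ∧ ∀ x o, g (Sum.elim x (Sum.elim o 0)) =
            Sum.elim x (Sum.elim (o + f x) 0) := by
  classical
  obtain ⟨Q, _, bot, top, hQ, H⟩ := exists_fanout_sum k
  obtain ⟨e⟩ : Nonempty (Fin n ↪ Q) := Embedding.nonempty_of_card_le (by simpa [hQ] using hk)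
  refine ⟨Fin n × Q ⊕ Fin n × Q, inferInstance, by simp [hQ, two_mul], fun f => ?_⟩
  let out : Fin n → Fin n ⊕ (Fin n × Q ⊕ Fin n × Q) := fun i => Sum.inr (Sum.inr (i, top))
  have hV : ∃ v : Bits (Fin n ⊕ (Fin n × Q ⊕ Fin n × Q)) → Bits (Fin n ⊕ (Fin n × Q ⊕ Fin n × Q)), CnotDepth (2 * k + 2) v ∧
      ∀ x i, v (Sum.elim x 0) (out i) = f x i := by
    let M := LinearMap.toMatrix' f
    obtain ⟨l, hl, hl₁, hl₂⟩ := exists_cnotLayer (ι := Fin n ⊕ (Fin n × Q ⊕ Fin n × Q)) (K := Fin n)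
      (c := Sum.inl) (t := fun j => Sum.inr (Sum.inl (j, bot)))
      Sum.inl_injective (fun p p' h => by simpa using h) (fun p p' h => by simp at h)
    obtain ⟨z, hz, hz₁, hz₂, -⟩ := H _ (Fin n) (fun p => Sum.inr (Sum.inl p))
      (Sum.inr_injective.comp Sum.inl_injective)
    -- Each nonzero entry `(i, j)` has its own copy of `x j` and its own slot in row `i`, so all
    -- these gates fit in one layer.
    obtain ⟨l', hl', hl'₁, hl'₂⟩ := exists_cnotLayer (ι := Fin n ⊕ (Fin n × Q ⊕ Fin n × Q))
      (K := {p : Fin n × Fin n // M p.1 p.2 = 1})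
      (c := fun p => Sum.inr (Sum.inl (p.1.2, e p.1.1)))
      (t := fun p => Sum.inr (Sum.inr (p.1.1, e p.1.2)))
      (fun p p' h => by
        simp only [Sum.inr.injEq, Sum.inl.injEq, Prod.mk.injEq, e.injective.eq_iff] at h
        exact Subtype.ext (Prod.ext h.2 h.1))
      (fun p p' h => by
        simp only [Sum.inr.injEq, Prod.mk.injEq, e.injective.eq_iff] at h
        exact Subtype.ext (Prod.ext h.1 h.2))
      (fun p p' h => by simp at h)
    obtain ⟨z', hz', -, -, hz'₃⟩ := H _ (Fin n) (fun p => Sum.inr (Sum.inr p))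
      (Sum.inr_injective.comp Sum.inr_injective)
    refine ⟨z' ∘ l' ∘ z ∘ l, ?_, fun x i => ?_⟩
    · have := hz'.comp (hl'.comp (hz.comp hl))
      convert this using 1
      ring
    set a : Bits (Fin n ⊕ (Fin n × Q ⊕ Fin n × Q)) := Sum.elim x 0 with ha
    have h₁ : ∀ j q, z (l a) (Sum.inr (Sum.inl (j, q))) = x j := by
      intro j q
      refine (hz₂ (l a) j ?_ q).trans ?_
      · intro q hq
        rw [hl₂]
        · rfl
        · rintro ⟨j', h⟩
          simp only [Sum.inr.injEq, Sum.inl.injEq, Prod.mk.injEq] at h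
          exact hq h.2.symm
      · refine (hl₁ a j).trans ?_
        simp [ha]
    have h₂ : ∀ p, z (l a) (Sum.inr (Sum.inr p)) = 0 := by
      intro p
      rw [hz₁ _ _ (by simp), hl₂ _ _ (by simp)]
      rfl
    refine (hz'₃ (l' (z (l a))) i).trans ?_
    rw [← Fintype.sum_of_injective e e.injective (fun j => M i j * x j)]
    · rw [← LinearMap.toMatrix'_mulVec]
      rfl
    · intro q hq
      rw [hl'₂, h₂]
      rintro ⟨p, h⟩
      simp only [Sum.inr.injEq, Prod.mk.injEq] at h
      exact hq ⟨_, h.2⟩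
    · intro j
      by_cases hM : M i j = 1
      · refine Eq.symm ((hl'₁ (z (l a)) ⟨(i, j), hM⟩).trans ?_)
        simp only [h₁, h₂, hM, zero_add, one_mul]
      · rw [hl'₂, h₂]
        · have h01 : ∀ u : ZMod 2, u ≠ 1 → u = 0 := by decide
          rw [h01 _ hM, zero_mul]
        · rintro ⟨⟨p, hp⟩, h⟩
          simp only [Sum.inr.injEq, Prod.mk.injEq, e.injective.eq_iff] at h
          rw [h.1, h.2] at hp
          exact hM hp
  obtain ⟨v, hv, hv₁⟩ := hV
  obtain ⟨w, hw, hwv⟩ := hv.exists_leftInverse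
  let j : Fin n ⊕ (Fin n × Q ⊕ Fin n × Q) → Fin n ⊕ (Fin n ⊕ (Fin n × Q ⊕ Fin n × Q)) := Sum.map id Sum.inr
  have hj : Injective j := injective_id.sumMap Sum.inr_injective
  have hjr : ∀ i, Sum.inr (Sum.inl i) ∉ Set.range j := by
    rintro i ⟨y | y, h⟩ <;> simp [j] at h
  obtain ⟨l, hl, hl₁, hl₂⟩ := exists_cnotLayer (K := Fin n)
    (c := fun i => j (out i)) (t := fun i => Sum.inr (Sum.inl i))
    (fun p p' h => by simpa [out] using hj h) (fun p p' h => by simpa using h)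
    (fun p p' h => hjr p' ⟨_, h⟩)
  -- Compute, copy out, uncompute: depth `2 * (2 * k + 2) + 1`. The middle layer changes only qubits
  -- outside the range of `j`, so `w` still undoes `v`.
  refine ⟨lift j w ∘ l ∘ lift j v, ?_, fun x o => ?_⟩
  · convert (hw.lift hj).comp (hl.comp (hv.lift hj)) using 1
    ring
  set a : Bits (Fin n ⊕ (Fin n ⊕ (Fin n × Q ⊕ Fin n × Q))) := Sum.elim x (Sum.elim o 0) with ha
  have haj : a ∘ j = Sum.elim x 0 := by
    funext y
    rcases y with y | y <;> rfl
  have h₁ : l (lift j v a) ∘ j = v (Sum.elim x 0) := by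
    funext y
    rw [comp_apply, hl₂, lift_apply hj, haj]
    rintro ⟨i, hi⟩
    exact hjr i ⟨_, hi.symm⟩
  simp only [comp_apply]
  have h₂ : ∀ y, lift j w (l (lift j v a)) (j y) = (Sum.elim x 0 : Bits (Fin n ⊕ (Fin n × Q ⊕ Fin n × Q))) y := by
    intro y
    rw [lift_apply hj, h₁, hwv]
  funext y
  rcases y with y | y | y
  · exact h₂ (Sum.inl y)
  · rw [lift_apply_of_notMem _ _ (hjr y), hl₁, lift_apply hj, haj, hv₁,
      lift_apply_of_notMem _ _ (hjr y)]
    rfl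
  · exact h₂ (Sum.inr y)

/-- An invertible linear map can be applied in place by `8 k + 12` layers of controlled-not gates
with `n + 2 n 2 ^ k` ancillae. -/
theorem exists_cnotDepth_linearEquiv (n k : ℕ) (hk : n ≤ 2 ^ k)
    (f : Bits (Fin n) ≃ₗ[ZMod 2] Bits (Fin n)) :
    ∃ g : Bits (Fin n ⊕ Fin (n + 2 * (n * 2 ^ k))) → Bits (Fin n ⊕ Fin (n + 2 * (n * 2 ^ k))),
      CnotDepth (8 * k + 12) g ∧ ∀ x, g (Sum.elim x 0) = Sum.elim (f x) 0 := by
  obtain ⟨W, _, hW, H⟩ := exists_addLinear n k hk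
  obtain ⟨g, hg, hg₁⟩ := H f.toLinearMap
  obtain ⟨h, hh, hh₁⟩ := H f.symm.toLinearMap
  let s : Fin n ⊕ (Fin n ⊕ W) → Fin n ⊕ (Fin n ⊕ W) := Sum.elim (Sum.inr ∘ Sum.inl) (Sum.elim Sum.inl (Sum.inr ∘ Sum.inr))
  have hss : Involutive s := by rintro (i | i | i) <;> rfl
  have hs : Injective s := hss.injective
  obtain ⟨l, hl, hl₁, hl₂⟩ := exists_cnotLayer (ι := Fin n ⊕ (Fin n ⊕ W)) (K := Fin n)
    (c := fun i => Sum.inr (Sum.inl i)) (t := Sum.inl)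
    (Sum.inr_injective.comp Sum.inl_injective) Sum.inl_injective (fun p p' h => by simp at h)
  obtain ⟨l', hl', hl'₁, hl'₂⟩ := exists_cnotLayer (ι := Fin n ⊕ (Fin n ⊕ W)) (K := Fin n)
    (c := Sum.inl) (t := fun i => Sum.inr (Sum.inl i))
    Sum.inl_injective (Sum.inr_injective.comp Sum.inl_injective) (fun p p' h => by simp at h)
  -- `s` exchanges input and output registers. Once the input is erased, two layers rather than
  -- three move `f x` back, for a total of `2 * (4 * k + 5) + 2`.
  have hG : CnotDepth (8 * k + 12) (l' ∘ l ∘ lift s h ∘ g) := by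
    convert hl'.comp (hl.comp ((hh.lift hs).comp hg)) using 1
    ring
  have hG₁ : ∀ x, (l' ∘ l ∘ lift s h ∘ g) (Sum.elim x 0) = Sum.elim (f x) 0 := by
    intro x
    have e₀ : (Sum.elim x 0 : Bits (Fin n ⊕ (Fin n ⊕ W))) = Sum.elim x (Sum.elim (0 : Bits (Fin n)) 0) := by
      funext y
      rcases y with y | y | y <;> rfl
    have e₁ : g (Sum.elim x 0) = Sum.elim x (Sum.elim (f x) 0) := by
      rw [e₀, hg₁, zero_add]; rfl
    have e₂ : lift s h (g (Sum.elim x 0)) =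
        Sum.elim (0 : Bits (Fin n)) (Sum.elim (f x) 0) := by
      have e₃ : g (Sum.elim x 0) ∘ s = Sum.elim (f x) (Sum.elim x 0) := by
        rw [e₁]
        funext y
        rcases y with y | y | y <;> rfl
      have e₄ := lift_comp_self hs h (g (Sum.elim x 0))
      rw [e₃, hh₁] at e₄
      funext y
      rw [← hss y]
      refine (congrFun e₄ (s y)).trans ?_
      rcases y with y | y | y
      · simp only [s, Sum.elim_inl, Sum.elim_inr, comp_apply, LinearEquiv.coe_coe,
          LinearEquiv.symm_apply_apply, Pi.add_apply, CharTwo.add_self_eq_zero, Pi.zero_apply]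
      · rfl
      · rfl
    have e₅ : l (lift s h (g (Sum.elim x 0))) = Sum.elim (f x) (Sum.elim (f x) 0) := by
      rw [e₂]
      funext y
      rcases y with y | y
      · rw [hl₁]
        simp
      · rw [hl₂ _ _ (by simp)]
        rfl
    simp only [comp_apply]
    rw [e₅]
    funext y
    rcases y with y | y | y
    · rw [hl'₂ _ _ (by simp)]
      rfl
    · rw [hl'₁]
      simp [CharTwo.add_self_eq_zero]
    · rw [hl'₂ _ _ (by simp)]
      rfl
  let E : Fin n ⊕ W ≃ Fin (n + 2 * (n * 2 ^ k)) := Fintype.equivFinOfCardEq (by simp [hW])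
  let j : Fin n ⊕ (Fin n ⊕ W) → Fin n ⊕ Fin (n + 2 * (n * 2 ^ k)) := Sum.map id E
  have hj : Injective j := injective_id.sumMap E.injective
  refine ⟨lift j (l' ∘ l ∘ lift s h ∘ g), hG.lift hj, fun x => ?_⟩
  have hx : (Sum.elim x 0 : Bits (Fin n ⊕ Fin (n + 2 * (n * 2 ^ k)))) ∘ j = Sum.elim x 0 := by
    funext y
    rcases y with y | y <;> rfl
  have key := lift_comp_self hj (l' ∘ l ∘ lift s h ∘ g) (Sum.elim x 0)
  rw [hx, hG₁] at key
  funext y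
  rcases y with y | y
  · exact congrFun key (Sum.inl y)
  · have := congrFun key (Sum.inr (E.symm y))
    simpa [j] using this

/-! ### From classical maps to unitary operators -/

section Operators

variable {ι : Type} [Fintype ι]

/-- The operator that permutes the basis states according to a classical map. -/
def opOf (f : Bits ι → Bits ι) : Op ι :=
  Matrix.of fun b a => if b = f a then 1 else 0

theorem opOf_id : opOf (id : Bits ι → Bits ι) = 1 := by
  ext b a
  simp [opOf, Matrix.one_apply]

variable [DecidableEq ι]

theorem opOf_comp (f g : Bits ι → Bits ι) : opOf (f ∘ g) = opOf f * opOf g := by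
  ext b a
  simp [opOf, Matrix.mul_apply]

theorem isQuantumOperator_opOf {f : Bits ι → Bits ι} (hf : Involutive f) :
    IsQuantumOperator (opOf f) := by
  have hstar : star (opOf f) = opOf f := by
    ext b a
    simp only [opOf, Matrix.star_apply, Matrix.of_apply, apply_ite star, star_one, star_zero]
    exact if_congr (eq_comm.trans hf.eq_iff) rfl rfl
  rw [IsQuantumOperator, Matrix.mem_unitaryGroup_iff, hstar, ← opOf_comp, hf.comp_self, opOf_id]

/-- The map `p` sends each target to its control and fixes every other qubit. Its fibres are the
blocks: a fixed point and at most one target, since controls are distinct. -/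
theorem IsCnotLayer.isOneLayer {f : Bits ι → Bits ι} (hf : IsCnotLayer f) :
    IsOneLayer (opOf f) := by
  classical
  obtain ⟨K, c, t, hc, ht, hct, h₁, h₂⟩ := hf
  let p : ι → ι := extend t c id
  have hpt : ∀ k, p (t k) = c k := ht.extend_apply _ _
  have hp : ∀ i, i ∉ Set.range t → p i = i := fun i hi => extend_apply' _ _ _ hi
  have hpc : ∀ k, p (c k) = c k := fun k => hp _ fun ⟨l, hl⟩ => hct k l hl.symm
  have hpp : ∀ i, p (p i) = p i := by
    intro i
    by_cases hi : i ∈ Set.range t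
    · obtain ⟨k, rfl⟩ := hi
      rw [hpt, hpc]
    · rw [hp i hi, hp i hi]
  have hinj : ∀ i i', p i ≠ i → p i' ≠ i' → p i = p i' → i = i' := by
    intro i i' hi hi' h
    obtain ⟨k, rfl⟩ := not_not.1 (mt (hp i) hi)
    obtain ⟨k', rfl⟩ := not_not.1 (mt (hp i') hi')
    rw [hpt, hpt] at h
    rw [hc h]
  have hfp : ∀ a i, f a i = if p i = i then a i else a i + a (p i) := by
    intro a i
    by_cases hi : i ∈ Set.range t
    · obtain ⟨k, rfl⟩ := hi
      rw [hpt, h₁, if_neg (hct k k)]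
    · rw [h₂ a i hi, if_pos (hp i hi)]
  let P : Finpartition (Finset.univ : Finset ι) := Finpartition.ofSetoid (Setoid.ker p)
  have hP : ∀ s ∈ P.parts, ∀ i ∈ s, ∀ i', i' ∈ s ↔ p i' = p i := by
    intro s hs i hi i'
    rw [← P.part_eq_of_mem hs hi, Finpartition.mem_part_ofSetoid_iff_rel]
    exact eq_comm
  -- The test `p i ∈ s` always succeeds on blocks; it only makes the gate defined on every `s`.
  let h : ∀ s : Finset ι, Bits s → Bits s := fun s a i =>
    if hi : p i ≠ i ∧ p i ∈ s then a i + a ⟨p i, hi.2⟩ else a i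
  have hinv : ∀ s, Involutive (h s) := by
    intro s a
    funext i
    by_cases hi : p i ≠ i ∧ p i ∈ s
    · have hi' : h s a ⟨p i, hi.2⟩ = a ⟨p i, hi.2⟩ := dif_neg fun hh => hh.1 (hpp i)
      have e : ∀ b, h s b i = b i + b ⟨p i, hi.2⟩ := fun b => dif_pos hi
      rw [e, e, hi', add_assoc, CharTwo.add_self_eq_zero, add_zero]
    · have e : ∀ b, h s b i = b i := fun b => dif_neg hi
      rw [e, e]
  refine ⟨P, fun s => opOf (h s), fun s hs => ?_, fun s _ => isQuantumOperator_opOf (hinv s),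
    fun b a => ?_⟩
  · by_contra! hcard
    obtain ⟨x, hx, y, hy, z, hz, hxy, hxz, hyz⟩ := Finset.two_lt_card.1 hcard
    have e₁ := (hP s hs x hx y).1 hy
    have e₂ := (hP s hs x hx z).1 hz
    have i₁ := hinj x y
    have i₂ := hinj x z
    have i₃ := hinj y z
    grind
  · have hres : ∀ s ∈ P.parts, ∀ i : s, h s (fun i => a i) i = f a i := by
      intro s hs i
      have hmem : p i ∈ s := (hP s hs i i.2 _).2 (hpp _)
      rw [hfp]
      by_cases hi : p i = i
      · rw [if_pos hi]
        exact dif_neg fun hh => hh.1 hi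
      · rw [if_neg hi]
        exact dif_pos ⟨hi, hmem⟩
    simp only [opOf, Matrix.of_apply, Finset.prod_ite_zero, Finset.prod_const_one]
    refine if_congr ⟨?_, ?_⟩ rfl rfl
    · rintro rfl s hs
      funext i
      exact (hres s hs i).symm
    · intro H
      funext i
      obtain ⟨s, hs, hi⟩ := P.exists_mem (Finset.mem_univ i)
      exact (congrFun (H s hs) ⟨i, hi⟩).trans (hres s hs ⟨i, hi⟩)

theorem CnotDepth.isCircuitOfDepth {d : ℕ} {f : Bits ι → Bits ι} (hf : CnotDepth d f) :
    IsCircuitOfDepth d (opOf f) := by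
  induction hf with
  | zero => exact ⟨[], rfl, by simp, by rw [List.prod_nil, opOf_id]⟩
  | @succ d f l _ hl ih =>
    obtain ⟨L, hd, hL, hprod⟩ := ih
    refine ⟨opOf l :: L, by simp [hd], ?_, by rw [List.prod_cons, hprod, opOf_comp]⟩
    intro V hV
    rcases List.mem_cons.1 hV with rfl | hV
    · exact hl.isOneLayer
    · exact hL V hV

theorem IsCnotCircuit.isQuantumOperator {U : Op ι} (hU : IsCnotCircuit U) :
    IsQuantumOperator U := by
  obtain ⟨L, hL, rfl⟩ := hU
  refine Submonoid.list_prod_mem _ fun V hV => ?_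
  obtain ⟨p, hp, rfl⟩ := List.mem_map.1 hV
  exact isQuantumOperator_opOf (involutive_update_add (hL p hp))

/-- Each gate is a linear involution of the basis states, and such maps compose. -/
theorem IsCnotCircuit.exists_linearEquiv {U : Op ι} (hU : IsCnotCircuit U) :
    ∃ f : Bits ι ≃ₗ[ZMod 2] Bits ι, U = opOf f := by
  obtain ⟨L, hL, rfl⟩ := hU
  induction L with
  | nil => exact ⟨LinearEquiv.refl _ _, opOf_id.symm⟩
  | cons p L ih =>
    obtain ⟨f, hf⟩ := ih fun q hq => hL q (List.mem_cons_of_mem _ hq)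
    let g : Bits ι →ₗ[ZMod 2] Bits ι :=
      { toFun := fun a => update a p.2 (a p.2 + a p.1)
        map_add' := fun a b => by
          funext i
          by_cases hi : i = p.2
          · subst hi
            simp only [update_self, Pi.add_apply]
            ring
          · simp [update_of_ne hi]
        map_smul' := fun r a => by
          funext i
          by_cases hi : i = p.2
          · subst hi
            simp [mul_add]
          · simp [update_of_ne hi] }
    refine ⟨f.trans (LinearEquiv.ofInvolutive g
      (involutive_update_add (hL p List.mem_cons_self))), ?_⟩
    rw [List.map_cons, List.prod_cons, hf]
    exact (opOf_comp g f).symm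

end Operators

/-! ### Embedding and the explicit bounds -/

theorem isEmbeddedIn_opOf {n m : ℕ} {f : Bits (Fin n) → Bits (Fin n)}
    {g : Bits (Fin n ⊕ Fin m) → Bits (Fin n ⊕ Fin m)}
    (h : ∀ x, g (Sum.elim x 0) = Sum.elim (f x) 0) : IsEmbeddedIn (opOf f) (opOf g) := by
  constructor
  · intro a b c hc
    simp only [opOf, Matrix.of_apply, h]
    refine if_neg fun hh => hc ?_
    funext i
    exact congrFun hh (Sum.inr i)
  · intro a b
    simp only [opOf, Matrix.of_apply, h]
    refine if_congr ⟨fun hh => ?_, fun hh => by rw [hh]⟩ rfl rfl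
    funext i
    exact congrFun hh (Sum.inl i)

theorem IsCnotCircuit.exists_embedding {n : ℕ} (hn : 1 ≤ n) {U : Op (Fin n)}
    (hU : IsCnotCircuit U) :
    ∃ (m d : ℕ) (M : Op (Fin n ⊕ Fin m)),
      (d : ℝ) ≤ 28 / Real.log 2 * Real.log n ∧ (m : ℝ) ≤ 5 * (n : ℝ) ^ 2 ∧
      IsCircuitOfDepth d M ∧ IsEmbeddedIn U M := by
  obtain ⟨f, rfl⟩ := hU.exists_linearEquiv
  -- For `n = 1` the bound `log n = 0` forces depth `0`; the only invertible linear map on one bit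
  -- is the identity.
  rcases hn.eq_or_lt with rfl | hn
  · refine ⟨0, 0, opOf id, by simp, by norm_num, CnotDepth.zero.isCircuitOfDepth, ?_⟩
    refine isEmbeddedIn_opOf fun x => ?_
    have hx : f x = x := by
      have h01 : ∀ u v : ZMod 2, (u = 0 ↔ v = 0) → u = v := by decide
      have hz : ∀ y : Bits (Fin 1), y 0 = 0 ↔ y = 0 := fun y =>
        ⟨fun h => funext fun i => by rw [Subsingleton.elim i 0, h]; rfl, fun h => by rw [h]; rfl⟩
      funext i
      rw [Subsingleton.elim i 0]
      exact h01 _ _ (by rw [hz, hz, LinearEquiv.map_eq_zero_iff])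
    rw [hx, id]
  · have hk : n ≤ 2 ^ Nat.clog 2 n := Nat.le_pow_clog one_lt_two n
    have hk' : 2 ^ (Nat.clog 2 n - 1) < n := Nat.pow_pred_clog_lt_self one_lt_two hn
    have hk₀ : 0 < Nat.clog 2 n := Nat.clog_pos one_lt_two hn
    obtain ⟨k, hk₁⟩ := Nat.exists_eq_succ_of_ne_zero hk₀.ne'
    rw [hk₁] at hk hk'
    rw [Nat.succ_sub_one] at hk'
    obtain ⟨g, hg, hg₁⟩ := exists_cnotDepth_linearEquiv n k.succ hk f
    -- Here `2 ^ k < n ≤ 2 ^ (k + 1)`. The depth is `8 * k + 20`, and both `k` and `1` are at most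
    -- `log n / log 2`, giving `28`. The ancillae number `n + 4 * n * 2 ^ k ≤ 5 * n ^ 2`.
    refine ⟨_, _, opOf g, ?_, ?_, hg.isCircuitOfDepth, isEmbeddedIn_opOf hg₁⟩
    · have hlog : 0 < Real.log 2 := Real.log_pos one_lt_two
      have hn0 : (0 : ℝ) < n := by exact_mod_cast (by omega : 0 < n)
      have b₁ : Real.log 2 ≤ Real.log n := Real.log_le_log two_pos (by exact_mod_cast hn)
      have b₂ : k * Real.log 2 ≤ Real.log n := by
        rw [← Real.log_pow]
        exact Real.log_le_log (by positivity) (by exact_mod_cast hk'.le)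
      rw [div_mul_eq_mul_div, le_div_iff₀ hlog]
      push_cast
      linarith
    · have hm : n + 2 * (n * 2 ^ k.succ) ≤ 5 * n ^ 2 := by
        rw [pow_succ]
        nlinarith
      exact_mod_cast hm

end QCirc

theorem mainTheorem1 :
    (∃ c₁ c₂ : ℝ, ∀ n : ℕ, 1 ≤ n → ∀ U : QCirc.Op (Fin n), QCirc.IsCnotCircuit U →
      ∃ (m d : ℕ) (M : QCirc.Op (Fin n ⊕ Fin m)),
        (d : ℝ) ≤ c₁ * Real.log n ∧ (m : ℝ) ≤ c₂ * (n : ℝ) ^ 2 ∧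
        QCirc.IsCircuitOfDepth d M ∧ QCirc.IsEmbeddedIn U M) ∧
    (∀ F : ∀ n : ℕ, QCirc.Op (Fin n), (∀ n, QCirc.IsCnotCircuit (F n)) → F ∈ QCirc.QNC 1) := by
  refine ⟨⟨28 / Real.log 2, 5, fun n hn U hU => hU.exists_embedding hn⟩, fun F hF => ?_⟩
  refine ⟨fun n => (hF n).isQuantumOperator, 28 / Real.log 2, 5, 2, fun n hn => ?_⟩
  simpa only [pow_one] using (hF n).exists_embedding hn
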